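/- Let $G$ be a finite group with a supercharacter theory $S$, that is, a partition $\mathcal X$ of $\mathrm{Irr}(G)$ and a partition $\mathcal Y$ of $G$ such that $\{1\}\in\mathcal Y$, $|\mathcal X|=|\mathcal Y|$, and for each $X\in\mathcal X$ the character $\sigma_X=\sum_{\chi\in X}\chi(1)\chi$ is constant on each member of $\mathcal Y$. The $\sigma_X$ are the supercharacters, the members of $\mathcal Y$ are the superclasses, and $\mathrm{Cl}_S(g)$ is the superclass of $g$. A subgroup is $S$-normal if it is a union of superclasses. For an $S$-normal subgroup $N$, which is normal in $G$, let $S^{G/N}$ be the supercharacter theory of $G/N$ whose superclasses are the images of the superclasses of $S$ under $G\to G/N$. For $H\le G$ put $[H,S]=\langle g^{-1}k : g\in H,\ k\in \mathrm{Cl}_S(g)\rangle$, and let $Z(S)=\{g\in G : |\mathrm{Cl}_S(g)|=1\}$. The group $G$ is $S$-nilpotent if there is a series $G=N_1\ge N_2\ge\cdots\ge N_{r+1}=1$ of $S$-normal subgroups with $N_i/N_{i+1}\le Z(S^{G/N_{i+1}})$ for all $i$. Its $S$-nilpotence class is then the least positive integer $c$ with $\zeta_c(S)=G$, where $\zeta_0(S)=1$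 and $\zeta_{i}(S)/\zeta_{i-1}(S)=Z(S^{G/\zeta_{i-1}(S)})$ for $i\ge 1$. Let $\gamma_1(S)=G$ and $\gamma_i(S)=[\gamma_{i-1}(S),S]$ for $i\ge 2$. Let $V(S)$ be the subgroup generated by all $g\in G$ such that $\chi(g)\ne 0$ for some supercharacter $\chi$ whose kernel does not contain $[G,S]$. Finally let $V_1(S)=V(S)$ and $V_i(S)=[V_{i-1}(S),S]$ for $i\ge 2$. Write $\gamma_i=\gamma_i(S)$ and $V_i=V_i(S)$; these subgroups are all $S$-normal. **Theorem.** 1. For all $i\ge 1$, $\gamma_{i+1}\le V_i\le\gamma_i$. 2. If $V_n<\gamma_n$ for some $n\ge 1$, then $V_i<\gamma_i$ for all $1\le i\le n$. 3. If $V_n<\gamma_n$ for some $n\ge 1$, then $G/V_n$ is $S^{G/V_n}$-nilpotent with $S^{G/V_n}$-nilpotence class $n$, and for all $1\le i\le n$ one has $V_n\le V_i$ and $V_i(S^{G/V_n})=V_i(S)/V_n(S)$. -/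

import Mathlib

/-- The set `Irr(G)` of complex irreducible characters of `G`. -/
def Irr (G : Type*) [Group G] : Set (G → ℂ) :=
  {χ | ∃ (V : Type) (_ : AddCommGroup V) (_ : Module ℂ V) (_ : FiniteDimensional ℂ V)
    (ρ : Representation ℂ G V), ρ.IsIrreducible ∧ χ = ρ.character}

namespace Irr

theorem map_conj {G : Type*} [Group G] (χ : Irr G) (g h : G) : χ.1 (h * g * h⁻¹) = χ.1 g := by
  obtain ⟨χ, V, _, _, _, ρ, hρ, rfl⟩ := χ
  exact ρ.char_conj g h

theorem nontrivial_of_irreducible {G V : Type*} [Group G] [AddCommGroup V] [Module ℂ V]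
    (ρ : Representation ℂ G V) (hρ : ρ.IsIrreducible) : Nontrivial V := by
  by_contra h
  rw [not_nontrivial_iff_subsingleton] at h
  apply (bot_ne_top : (⊥ : Subrepresentation ρ) ≠ ⊤)
  apply Subrepresentation.toSubmodule_injective
  exact Subsingleton.elim _ _

/-- The degree of a character is a positive real number. -/
theorem degree {G : Type*} [Group G] (χ : Irr G) : ∃ d : ℕ, d ≠ 0 ∧ χ.1 1 = d := by
  obtain ⟨χ, V, _, _, _, ρ, hρ, rfl⟩ := χ
  have := nontrivial_of_irreducible ρ hρ
  exact ⟨Module.finrank ℂ V, Module.finrank_pos.ne', ρ.char_one⟩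

theorem degree_ne_zero {G : Type*} [Group G] (χ : Irr G) : χ.1 1 ≠ 0 := by
  obtain ⟨d, hd, h⟩ := degree χ
  rw [h]; exact_mod_cast hd

/-- Schur's lemma for the operator attached to a class function. -/
theorem sum_smul_scalar {G V : Type*} [Group G] [Fintype G] [AddCommGroup V] [Module ℂ V]
    [FiniteDimensional ℂ V] (ρ : Representation ℂ G V) (hρ : ρ.IsIrreducible)
    (f : G → ℂ) (hf : ∀ g h, f (h * g * h⁻¹) = f g) :
    ∃ c : ℂ, ∑ h, f h • ρ h⁻¹ = c • (1 : V →ₗ[ℂ] V) := by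
  have comm : ∀ g, (∑ h, f h • ρ h⁻¹) * ρ g = ρ g * ∑ h, f h • ρ h⁻¹ := by
    intro g
    rw [Finset.sum_mul, Finset.mul_sum]
    refine Fintype.sum_equiv (MulAut.conj g⁻¹).toEquiv _ _ fun h => ?_
    simp only [smul_mul_assoc, mul_smul_comm, ← map_mul]
    have h1 : f ((MulAut.conj g⁻¹) h) = f h := by
      rw [MulAut.conj_apply]; exact hf _ _
    have h2 : h⁻¹ * g = g * ((MulAut.conj g⁻¹) h)⁻¹ := by
      rw [MulAut.conj_apply]; group
    change f h • ρ (h⁻¹ * g) = f ((MulAut.conj g⁻¹) h) • ρ (g * ((MulAut.conj g⁻¹) h)⁻¹)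
    rw [h1, h2]
  let T : Representation.IntertwiningMap ρ ρ :=
    ⟨∑ h, f h • ρ h⁻¹, fun g => comm g⟩
  obtain ⟨c, hc⟩ :=
    (Representation.IsIrreducible.algebraMap_intertwiningMap_bijective_of_isAlgClosed
      (ρ := ρ)).2 T
  refine ⟨c, ?_⟩
  have := congrArg Representation.IntertwiningMap.toLinearMap hc
  rw [← show T.toLinearMap = ∑ h, f h • ρ h⁻¹ from rfl, ← this]
  ext v
  simp [Algebra.algebraMap_eq_smul_one]

theorem conv_eq {G : Type*} [Group G] [Fintype G] (χ : Irr G)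
    (f : G → ℂ) (hf : ∀ g h, f (h * g * h⁻¹) = f g) (g : G) :
    χ.1 1 * ∑ h, χ.1 (g * h⁻¹) * f h = (∑ h, χ.1 h⁻¹ * f h) * χ.1 g := by
  obtain ⟨χ, V, _, _, _, ρ, hρ, rfl⟩ := χ
  obtain ⟨c, hc⟩ := sum_smul_scalar ρ hρ f hf
  have key : ∀ g, ∑ h, ρ.character (g * h⁻¹) * f h = c * ρ.character g := by
    intro g
    have : LinearMap.trace ℂ V (ρ g * ∑ h, f h • ρ h⁻¹) = c * ρ.character g := by
      rw [hc]; simp [Representation.character]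
    rw [← this, Finset.mul_sum, map_sum]
    refine Finset.sum_congr rfl fun h _ => ?_
    rw [mul_smul_comm, ← map_mul, map_smul, smul_eq_mul, mul_comm]; rfl
  have k1 := key 1
  simp only [one_mul] at k1
  change ρ.character 1 * ∑ h, ρ.character (g * h⁻¹) * f h =
    (∑ h, ρ.character h⁻¹ * f h) * ρ.character g
  rw [key, k1]; ring

open Classical in
theorem orthogonality {G : Type*} [Group G] [Fintype G] (χ ψ : Irr G) :
    ∑ h, χ.1 h⁻¹ * ψ.1 h = if χ = ψ then (Nat.card G : ℂ) else 0 := by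
  have hG : (Nat.card G : ℂ) ≠ 0 := by exact_mod_cast Nat.card_pos.ne'
  let _ : Invertible (Nat.card G : ℂ) := invertibleOfNonzero hG
  obtain ⟨χ, V, _, _, _, ρ, hρ, rfl⟩ := χ
  obtain ⟨ψ, W, _, _, _, σ, hσ, rfl⟩ := ψ
  have h1 := Representation.char_orthonormal σ ρ
  have h2 := Representation.char_orthonormal ρ ρ
  rw [if_pos ⟨Representation.Equiv.refl ρ⟩] at h2
  have e : ∑ h, ρ.character h⁻¹ * σ.character h = Nat.card G *
      ((Nat.card G : ℂ)⁻¹ * ∑ h, σ.character h * ρ.character h⁻¹) := by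
    rw [mul_inv_cancel_left₀ hG]
    exact Finset.sum_congr rfl fun _ _ => mul_comm _ _
  rw [e, h1]
  split_ifs with a b b
  · simp
  · exact absurd (Subtype.ext (Representation.char_iso a.some)) b
  · have b' : ρ.character = σ.character := congrArg Subtype.val b
    rw [← b', h2] at h1
    simp only [if_neg a] at h1
    exact absurd h1 one_ne_zero
  · simp

theorem linearIndependent (G : Type*) [Group G] [Fintype G] :
    LinearIndependent ℂ (fun χ : Irr G => χ.1) := by
  classical
  rw [linearIndependent_iff']
  intro s a ha χ hχ
  have h0 : ∑ h, χ.1 h⁻¹ * (∑ ψ ∈ s, a ψ • ψ.1) h = 0 := by rw [ha]; simp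
  simp only [Finset.sum_apply, Pi.smul_apply, smul_eq_mul, Finset.mul_sum] at h0
  rw [Finset.sum_comm] at h0
  have h1 : ∀ ψ : Irr G, ∑ h, χ.1 h⁻¹ * (a ψ * ψ.1 h) =
      a ψ * if χ = ψ then (Nat.card G : ℂ) else 0 := by
    intro ψ
    rw [← orthogonality, Finset.mul_sum]
    exact Finset.sum_congr rfl fun _ _ => by ring
  simp only [h1, mul_ite, mul_zero, Finset.sum_ite_eq, hχ, if_true] at h0
  exact (mul_eq_zero.1 h0).resolve_right (by exact_mod_cast Nat.card_pos.ne')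

instance finite (G : Type*) [Group G] [Finite G] : Finite (Irr G) := by
  have := Fintype.ofFinite G
  exact (linearIndependent G).finite

open scoped ComplexOrder in
/-- A character value at an inverse is the complex conjugate. -/
theorem map_inv {G : Type*} [Group G] [Finite G] (χ : Irr G) (g : G) :
    χ.1 g⁻¹ = star (χ.1 g) := by
  classical
  have := Fintype.ofFinite G
  obtain ⟨χ, V, _, _, _, ρ, hρ, rfl⟩ := χ
  let b := Module.finBasis ℂ V
  let M : G → Matrix _ _ ℂ := fun x => LinearMap.toMatrix b b (ρ x)
  have M1 : M 1 = 1 := by simp [M]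
  have Mm : ∀ x y, M (x * y) = M x * M y := fun x y => by
    simp only [M, map_mul]; exact LinearMap.toMatrix_mul b _ _
  have tr : ∀ x, ρ.character x = (M x).trace := fun x =>
    LinearMap.trace_eq_matrix_trace ℂ b (ρ x)
  let P := ∑ x, (M x).conjTranspose * M x
  have hP : P.PosDef := by
    have e : P = (M 1).conjTranspose * M 1 +
        ∑ x ∈ Finset.univ.erase 1, (M x).conjTranspose * M x :=
      (Finset.add_sum_erase _ _ (Finset.mem_univ 1)).symm
    rw [e, M1]
    refine Matrix.PosDef.add_posSemidef (by simpa using Matrix.PosDef.one) ?_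
    exact Matrix.posSemidef_sum _ fun i _ => Matrix.posSemidef_conjTranspose_mul_self _
  have inv : (M g).conjTranspose * P * M g = P := by
    simp only [P, Finset.mul_sum, Finset.sum_mul]
    refine Fintype.sum_equiv (Equiv.mulRight g) _ _ fun x => ?_
    simp only [Equiv.coe_mulRight, Mm, Matrix.conjTranspose_mul, Matrix.mul_assoc]
  have u : IsUnit P.det := (Matrix.isUnit_iff_isUnit_det _).1 hP.isUnit
  have e2 : M g⁻¹ = P⁻¹ * ((M g).conjTranspose * P) := by
    have h1 : P * M g⁻¹ = (M g).conjTranspose * P := by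
      conv_lhs => rw [← inv]
      rw [Matrix.mul_assoc, ← Mm, mul_inv_cancel, M1, Matrix.mul_one]
    rw [← h1, ← Matrix.mul_assoc, Matrix.nonsing_inv_mul _ u, Matrix.one_mul]
  change ρ.character g⁻¹ = star (ρ.character g)
  rw [tr, tr, e2, Matrix.trace_mul_comm, Matrix.mul_assoc, Matrix.mul_nonsing_inv _ u,
    Matrix.mul_one, Matrix.trace_conjTranspose]

end Irr

/-- `σ_X = ∑_{χ ∈ X} χ(1) χ` for a set `X` of irreducible characters. -/
noncomputable def charSum {G : Type*} [Group G] (X : Set (Irr G)) (g : G) : ℂ :=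
  ∑ᶠ χ ∈ X, χ.1 1 * χ.1 g

/-- A supercharacter theory of `G`: a partition of `Irr(G)` and a partition of `G`, both given by
the equivalence relation whose classes are the parts. -/
structure SupercharacterTheory (G : Type*) [Group G] where
  /-- The partition of `Irr(G)`. -/
  charRel : Setoid (Irr G)
  /-- The partition of `G`. -/
  classRel : Setoid G
  /-- `{1}` is a part of the partition of `G`. -/
  one_mem_classes : {1} ∈ classRel.classes
  /-- The two partitions have the same number of parts. -/
  card_eq : charRel.classes.ncard = classRel.classes.ncard
  /-- `σ_X` is constant on each part of the partition of `G`. -/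
  constant : ∀ X ∈ charRel.classes, ∀ K ∈ classRel.classes, ∀ g ∈ K, ∀ h ∈ K,
    charSum X g = charSum X h

namespace SupercharacterTheory

variable {G : Type*} [Group G] (S : SupercharacterTheory G)

/-- The set `Irr(S)` of supercharacters. -/
def superchars : Set (G → ℂ) := charSum '' S.charRel.classes

/-- The superclass `Cl_S(g)` of `g`. -/
def superclass (g : G) : Set G := {k | S.classRel k g}

/-- A subgroup is `S`-normal if it is a union of superclasses. -/
def IsSNormal (N : Subgroup G) : Prop :=
  ∃ T ⊆ S.classRel.classes, (N : Set G) = ⋃₀ T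

/-- The kernel `{g | χ(g) = χ(1)}` of a character. -/
def charKer (χ : G → ℂ) : Set G := {g | χ g = χ 1}

/-- The set `Irr(S ∣ N)` of supercharacters that do not contain `N` in their kernel. -/
def supercharsNotContaining (N : Subgroup G) : Set (G → ℂ) :=
  {χ ∈ S.superchars | ¬ (N : Set G) ⊆ charKer χ}

/-- `[H, S]`, the subgroup generated by all `g⁻¹ k` with `g ∈ H` and `k ∈ Cl_S(g)`. -/
def commutator (H : Subgroup G) : Subgroup G :=
  Subgroup.closure {x | ∃ g ∈ H, ∃ k ∈ S.superclass g, x = g⁻¹ * k}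

/-- `V(S ∣ N)`, the subgroup generated by all `g` such that `χ(g) ≠ 0` for some `χ ∈ Irr(S ∣ N)`. -/
def vanishingOffRel (N : Subgroup G) : Subgroup G :=
  Subgroup.closure {g | ∃ χ ∈ S.supercharsNotContaining N, χ g ≠ 0}

/-- The vanishing-off subgroup `V(S) = V(S ∣ [G, S])`. -/
def vanishingOff : Subgroup G := S.vanishingOffRel (S.commutator ⊤)

/-- The lower `S`-central series `γ_1 = G`, `γ_{i+1} = [γ_i, S]`; the index `0` is not used. -/
def γ : ℕ → Subgroup G
  | 0 => ⊤
  | 1 => ⊤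
  | i + 2 => S.commutator (γ (i + 1))

/-- The series `V_1 = V(S)`, `V_{i+1} = [V_i, S]`; the index `0` is not used. -/
def V : ℕ → Subgroup G
  | 0 => ⊤
  | 1 => S.vanishingOff
  | i + 2 => S.commutator (V (i + 1))

theorem eq_one_of_rel {g : G} (h : S.classRel g 1) : g = 1 := by
  have h1 := (Setoid.eq_of_mem_classes S.one_mem_classes rfl (S.classRel.mem_classes 1) (S.classRel.refl 1))
  have : g ∈ {x | S.classRel x 1} := h
  rw [← h1] at this
  exact this

theorem isSNormal_iff {N : Subgroup G} :
    S.IsSNormal N ↔ ∀ g ∈ N, ∀ k, S.classRel k g → k ∈ N := by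
  constructor
  · rintro ⟨T, hT, e⟩ g hg k hk
    have hg' : g ∈ (N : Set G) := hg
    rw [e] at hg'
    obtain ⟨K, hK, hgK⟩ := hg'
    have : k ∈ (N : Set G) := by
      rw [e]
      refine ⟨K, hK, ?_⟩
      obtain ⟨x, rfl⟩ := hT hK
      exact S.classRel.trans hk hgK
    exact this
  · intro h
    refine ⟨{K ∈ S.classRel.classes | K ⊆ N}, fun _ hK => hK.1, ?_⟩
    ext g
    constructor
    · intro hg
      exact ⟨{k | S.classRel k g}, ⟨⟨g, rfl⟩, fun k hk => h g hg k hk⟩, S.classRel.refl g⟩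
    · rintro ⟨K, hK, hg⟩
      exact hK.2 hg

theorem mem_center_aux {g : G} :
    (S.superclass g).ncard = 1 ↔ ∀ k, S.classRel k g → k = g := by
  rw [Set.ncard_eq_one]
  constructor
  · rintro ⟨a, ha⟩ k hk
    have h1 : k ∈ S.superclass g := hk
    have h2 : g ∈ S.superclass g := S.classRel.refl g
    rw [ha] at h1 h2
    rw [Set.mem_singleton_iff.1 h1, Set.mem_singleton_iff.1 h2]
  · intro h
    exact ⟨g, Set.eq_singleton_iff_unique_mem.2 ⟨S.classRel.refl g, h⟩⟩

open Classical in
theorem indicator_rel {N : Subgroup G} (hN : S.IsSNormal N) (g h : G) (r : S.classRel g h) :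
    (if g ∈ N then 1 else 0 : ℂ) = if h ∈ N then 1 else 0 := by
  have : g ∈ N ↔ h ∈ N := ⟨fun t => S.isSNormal_iff.1 hN g t h (S.classRel.symm r),
    fun t => S.isSNormal_iff.1 hN h t g r⟩
  simp only [this]

/-- The supercharacter to which `χ` belongs. -/
noncomputable def σ (χ : Irr G) : G → ℂ := charSum {ψ | S.charRel ψ χ}

theorem σ_rel (χ : Irr G) {g h : G} (r : S.classRel g h) : S.σ χ g = S.σ χ h :=
  S.constant _ ⟨χ, rfl⟩ _ ⟨h, rfl⟩ g r h (S.classRel.refl h)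

end SupercharacterTheory

open Classical in
theorem charSum_eq {G : Type*} [Group G] [Fintype (Irr G)] (X : Set (Irr G)) (g : G) :
    charSum X g = ∑ χ : Irr G, if χ ∈ X then χ.1 1 * χ.1 g else 0 := by
  unfold charSum
  rw [finsum_eq_sum_of_fintype]
  refine Finset.sum_congr rfl fun χ _ => ?_
  by_cases h : χ ∈ X <;> simp [h]

open Classical in
/-- The inner product of `σ_X` with an irreducible character. -/
theorem sum_charSum {G : Type*} [Group G] [Fintype G] (X : Set (Irr G)) (χ : Irr G) :
    ∑ h, χ.1 h⁻¹ * charSum X h = if χ ∈ X then Nat.card G * χ.1 1 else 0 := by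
  have := Fintype.ofFinite (Irr G)
  simp only [charSum_eq, Finset.mul_sum]
  rw [Finset.sum_comm]
  have : ∀ ψ : Irr G, ∑ h, χ.1 h⁻¹ * (if ψ ∈ X then ψ.1 1 * ψ.1 h else 0) =
      if χ = ψ then (if ψ ∈ X then Nat.card G * ψ.1 1 else 0) else 0 := by
    intro ψ
    by_cases h : ψ ∈ X
    · simp only [h, if_true]
      have : ∑ x, χ.1 x⁻¹ * (ψ.1 1 * ψ.1 x) = ψ.1 1 * ∑ x, χ.1 x⁻¹ * ψ.1 x := by
        rw [Finset.mul_sum]; exact Finset.sum_congr rfl fun _ _ => by ring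
      rw [this, Irr.orthogonality]
      split_ifs <;> ring
    · simp [h]
  simp only [this, Finset.sum_ite_eq, Finset.mem_univ, if_true]

theorem charSum_conj {G : Type*} [Group G] (X : Set (Irr G)) (g h : G) :
    charSum X (h * g * h⁻¹) = charSum X g := by
  unfold charSum
  simp only [Irr.map_conj]

theorem charSum_inv {G : Type*} [Group G] [Finite G] (X : Set (Irr G)) (g : G) :
    charSum X g⁻¹ = star (charSum X g) := by
  classical
  have := Fintype.ofFinite (Irr G)
  simp only [charSum_eq, star_sum]
  refine Finset.sum_congr rfl fun χ _ => ?_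
  by_cases h : χ ∈ X
  · obtain ⟨d, -, hd⟩ := Irr.degree χ
    simp [h, Irr.map_inv, hd]
  · simp [h]

/-- The functions `σ_X`, seen on the set of parts of a partition of `G` on which they are
constant, are linearly independent. -/
theorem charSum_linearIndependent {G : Type*} [Group G] [Finite G] (r : Setoid (Irr G))
    (c : Setoid G) (F : Quotient r → Quotient c → ℂ)
    (hF : ∀ χ g, F (Quotient.mk r χ) (Quotient.mk c g) = charSum {ψ | r ψ χ} g) :
    LinearIndependent ℂ F := by
  classical
  have := Fintype.ofFinite G
  have := Fintype.ofFinite (Irr G)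
  rw [linearIndependent_iff']
  intro s a ha q hq
  induction q using Quotient.inductionOn with | h χ => ?_
  have h0 : ∑ h, χ.1 h⁻¹ * (∑ p ∈ s, a p • F p) (Quotient.mk c h) = 0 := by rw [ha]; simp
  simp only [Finset.sum_apply, Pi.smul_apply, smul_eq_mul, Finset.mul_sum] at h0
  rw [Finset.sum_comm] at h0
  have h1 : ∀ p : Quotient r, ∑ h, χ.1 h⁻¹ * (a p * F p (Quotient.mk c h)) =
      if Quotient.mk r χ = p then a p * (Nat.card G * χ.1 1) else 0 := by
    intro p
    induction p using Quotient.inductionOn with | h ψ => ?_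
    have : ∑ h, χ.1 h⁻¹ * (a ⟦ψ⟧ * F ⟦ψ⟧ (Quotient.mk c h)) =
        a ⟦ψ⟧ * ∑ h, χ.1 h⁻¹ * charSum {φ | r φ ψ} h := by
      rw [Finset.mul_sum]
      refine Finset.sum_congr rfl fun h _ => ?_
      rw [hF]; ring
    rw [this, sum_charSum]
    simp only [Set.mem_ofPred_eq, Quotient.eq, mul_ite, mul_zero]
  rw [Finset.sum_congr rfl fun p _ => h1 p] at h0
  rw [Finset.sum_ite_eq, if_pos hq] at h0
  refine (mul_eq_zero.1 h0).resolve_right (mul_ne_zero ?_ (Irr.degree_ne_zero χ))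
  exact_mod_cast Nat.card_pos.ne'

theorem ncard_classes {α : Type*} (r : Setoid α) : r.classes.ncard = Nat.card (Quotient r) :=
  Nat.card_congr (Setoid.quotientEquivClasses r).symm

namespace SupercharacterTheory

variable {G : Type*} [Group G] [Finite G] (S : SupercharacterTheory G)

/-- The supercharacters span the functions that are constant on superclasses. -/
theorem mem_span (f : G → ℂ) (hf : ∀ g h, S.classRel g h → f g = f h) :
    f ∈ Submodule.span ℂ (Set.range S.σ) := by
  classical
  have := Fintype.ofFinite (Quotient S.charRel)
  have := Fintype.ofFinite (Quotient S.classRel)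
  let F : Quotient S.charRel → Quotient S.classRel → ℂ := fun p q =>
    Quotient.liftOn₂ p q S.σ (by
      intro χ g ψ h h1 h2
      have : S.σ χ = S.σ ψ := by
        unfold σ
        congr 1
        ext φ
        exact ⟨fun h => S.charRel.trans h h1, fun h => S.charRel.trans h (S.charRel.symm h1)⟩
      rw [this]
      exact S.σ_rel _ h2)
  have li : LinearIndependent ℂ F := charSum_linearIndependent _ _ F fun _ _ => rfl
  have top : Submodule.span ℂ (Set.range F) = ⊤ := by
    refine li.span_eq_top_of_card_eq_finrank' ?_
    rw [Module.finrank_fintype_fun_eq_card, ← Nat.card_eq_fintype_card,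
      ← Nat.card_eq_fintype_card, ← ncard_classes, ← ncard_classes, S.card_eq]
  let π : (Quotient S.classRel → ℂ) →ₗ[ℂ] (G → ℂ) := LinearMap.funLeft ℂ ℂ (Quotient.mk _)
  let f' : Quotient S.classRel → ℂ := fun q => Quotient.liftOn q f hf
  have hf' : f' ∈ Submodule.span ℂ (Set.range F) := by rw [top]; trivial
  have := Submodule.mem_map_of_mem (f := π) hf'
  rw [Submodule.map_span] at this
  refine Submodule.span_mono ?_ this
  rintro _ ⟨_, ⟨p, rfl⟩, rfl⟩
  induction p using Quotient.inductionOn with | h χ => ?_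
  exact ⟨χ, rfl⟩

theorem rel_iff {g h : G} : S.classRel g h ↔ ∀ χ, S.σ χ g = S.σ χ h := by
  classical
  refine ⟨fun r χ => S.σ_rel χ r, fun H => ?_⟩
  have key : ∀ f ∈ Submodule.span ℂ (Set.range S.σ), f g = f h := by
    intro f hf
    induction hf using Submodule.span_induction with
    | mem f hf => obtain ⟨χ, rfl⟩ := hf; exact H χ
    | zero => rfl
    | add a b _ _ ha hb => simp [ha, hb]
    | smul c a _ ha => simp [ha]
  have := key (fun k => if S.classRel k h then 1 else 0) (S.mem_span _ fun a b r => by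
    have : S.classRel a h ↔ S.classRel b h :=
      ⟨fun t => S.classRel.trans (S.classRel.symm r) t, fun t => S.classRel.trans r t⟩
    simp only [this])
  by_contra hn
  simp [hn] at this

theorem rel_conj (g h : G) : S.classRel (h * g * h⁻¹) g :=
  S.rel_iff.2 fun _ => charSum_conj _ _ _

theorem rel_inv {g h : G} (r : S.classRel g h) : S.classRel g⁻¹ h⁻¹ := by
  rw [rel_iff] at r ⊢
  intro χ
  have := r χ
  unfold σ at *
  rw [charSum_inv, charSum_inv, this]

theorem conj_of_rel {f : G → ℂ} (hf : ∀ g h, S.classRel g h → f g = f h) (g h : G) :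
    f (h * g * h⁻¹) = f g := hf _ _ (S.rel_conj g h)

/-- The inner products of a superclass function with the characters in one part are
proportional to the degrees. -/
theorem inner_proportional [Fintype G] {f : G → ℂ} (hf : ∀ g h, S.classRel g h → f g = f h)
    {χ ψ : Irr G} (r : S.charRel χ ψ) :
    (∑ h, χ.1 h⁻¹ * f h) * ψ.1 1 = (∑ h, ψ.1 h⁻¹ * f h) * χ.1 1 := by
  classical
  have hs := S.mem_span f hf
  clear hf
  induction hs using Submodule.span_induction with
  | mem f hs =>
    obtain ⟨φ, rfl⟩ := hs
    unfold σ
    rw [sum_charSum, sum_charSum]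
    have : S.charRel χ φ ↔ S.charRel ψ φ :=
      ⟨fun t => S.charRel.trans (S.charRel.symm r) t, fun t => S.charRel.trans r t⟩
    simp only [Set.mem_ofPred_eq, this]
    split_ifs <;> ring
  | zero => simp
  | add a b _ _ ha hb =>
    simp only [Pi.add_apply, mul_add, Finset.sum_add_distrib, add_mul, ha, hb]
  | smul c a _ ha =>
    have : ∀ χ : Irr G, ∑ h, χ.1 h⁻¹ * (c • a) h = c * ∑ h, χ.1 h⁻¹ * a h := by
      intro χ
      rw [Finset.mul_sum]
      exact Finset.sum_congr rfl fun _ _ => by simp; ring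
    rw [this, this, mul_assoc, ha, mul_assoc]

/-- Convolution with a superclass function acts on a supercharacter by a scalar. -/
theorem conv_σ [Fintype G] {f : G → ℂ} (hf : ∀ g h, S.classRel g h → f g = f h)
    (χ : Irr G) (g : G) :
    χ.1 1 * ∑ h, S.σ χ (g * h⁻¹) * f h = (∑ h, χ.1 h⁻¹ * f h) * S.σ χ g := by
  classical
  have := Fintype.ofFinite (Irr G)
  unfold σ
  simp only [charSum_eq, Finset.sum_mul]
  rw [Finset.sum_comm]
  conv_lhs => rw [Finset.mul_sum]
  conv_rhs => rw [← Finset.sum_mul, Finset.mul_sum]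
  refine Finset.sum_congr rfl fun ψ _ => ?_
  by_cases r : S.charRel ψ χ
  · simp only [Set.mem_ofPred_eq, r, if_true]
    have h1 := Irr.conv_eq ψ f (S.conj_of_rel hf) g
    have h2 := S.inner_proportional hf r
    have h3 : ∑ h, ψ.1 1 * ψ.1 (g * h⁻¹) * f h = ψ.1 1 * ∑ h, ψ.1 (g * h⁻¹) * f h := by
      rw [Finset.mul_sum]; exact Finset.sum_congr rfl fun _ _ => by ring
    rw [h3, h1]
    linear_combination (ψ.1 g) * h2
  · simp [r]

/-- The convolution of two superclass functions is a superclass function. -/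
theorem conv_rel [Fintype G] {e f : G → ℂ} (he : ∀ g h, S.classRel g h → e g = e h)
    (hf : ∀ g h, S.classRel g h → f g = f h) {g k : G} (r : S.classRel g k) :
    ∑ h, e (g * h⁻¹) * f h = ∑ h, e (k * h⁻¹) * f h := by
  have hs := S.mem_span e he
  clear he
  induction hs using Submodule.span_induction with
  | mem e hs =>
    obtain ⟨χ, rfl⟩ := hs
    apply mul_left_cancel₀ (Irr.degree_ne_zero χ)
    rw [S.conv_σ hf, S.conv_σ hf, S.σ_rel χ r]
  | zero => simp
  | add a b _ _ ha hb =>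
    simp only [Pi.add_apply, add_mul, Finset.sum_add_distrib, ha, hb]
  | smul c a _ ha =>
    simp only [Pi.smul_apply, smul_eq_mul, mul_assoc, ← Finset.mul_sum, ha]

/-- The superclass of a product is contained in the product of the superclasses. -/
theorem exists_of_rel_mul {x y z : G} (r : S.classRel z (x * y)) :
    ∃ a b, S.classRel a x ∧ S.classRel b y ∧ z = a * b := by
  classical
  have := Fintype.ofFinite G
  let ind : G → G → ℂ := fun t k => if S.classRel k t then 1 else 0
  have hind : ∀ t a b, S.classRel a b → ind t a = ind t b := fun t a b r => by
    have : S.classRel a t ↔ S.classRel b t :=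
      ⟨fun u => S.classRel.trans (S.classRel.symm r) u, fun u => S.classRel.trans r u⟩
    simp only [ind, this]
  have h1 := S.conv_rel (hind x) (hind y) r
  by_contra hn
  push Not at hn
  have h0 : ∑ h, ind x (z * h⁻¹) * ind y h = 0 := by
    refine Finset.sum_eq_zero fun h _ => ?_
    by_cases h1 : S.classRel (z * h⁻¹) x
    · by_cases h2 : S.classRel h y
      · exact absurd (by group) (hn _ _ h1 h2)
      · simp [ind, h2]
    · simp [ind, h1]
  rw [h0] at h1
  have h2 : ∑ h, ind x (x * y * h⁻¹) * ind y h =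
      ((Finset.univ.filter fun h => S.classRel (x * y * h⁻¹) x ∧ S.classRel h y).card : ℂ) := by
    rw [Finset.card_filter]
    push_cast
    refine Finset.sum_congr rfl fun h _ => ?_
    by_cases h1 : S.classRel (x * y * h⁻¹) x <;> by_cases h2 : S.classRel h y <;>
      simp [ind, h1, h2]
  rw [h2] at h1
  have h3 := (Finset.card_eq_zero.1 (Nat.cast_eq_zero.1 h1.symm))
  have h4 : y ∈ Finset.univ.filter fun h => S.classRel (x * y * h⁻¹) x ∧ S.classRel h y := by
    simp
  rw [h3] at h4
  simp at h4

variable {S} in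
theorem IsSNormal.normal {N : Subgroup G} (hN : S.IsSNormal N) : N.Normal :=
  ⟨fun n hn g => S.isSNormal_iff.1 hN n hn _ (S.rel_conj n g)⟩

theorem isSNormal_closure {A : Set G} (hA : ∀ g ∈ A, ∀ k, S.classRel k g → k ∈ A) :
    S.IsSNormal (Subgroup.closure A) := by
  rw [isSNormal_iff]
  intro g hg
  induction hg using Subgroup.closure_induction with
  | mem g hg => exact fun k hk => Subgroup.subset_closure (hA g hg k hk)
  | one =>
    intro k hk
    rw [S.eq_one_of_rel hk]
    exact one_mem _
  | mul x y _ _ hx hy =>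
    intro k hk
    obtain ⟨a, b, ha, hb, rfl⟩ := S.exists_of_rel_mul hk
    exact mul_mem (hx a ha) (hy b hb)
  | inv x _ hx =>
    intro k hk
    have := S.rel_inv hk
    rw [inv_inv] at this
    exact inv_mem_iff.1 (hx _ this)

theorem isSNormal_commutator {H : Subgroup G} (hH : S.IsSNormal H) :
    S.IsSNormal (S.commutator H) := by
  refine S.isSNormal_closure ?_
  rintro _ ⟨g, hg, k, hk, rfl⟩ z hz
  obtain ⟨a, b, ha, hb, rfl⟩ := S.exists_of_rel_mul hz
  have ha' := S.rel_inv ha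
  rw [inv_inv] at ha'
  exact ⟨a⁻¹, S.isSNormal_iff.1 hH g hg _ ha', b,
    S.classRel.trans hb (S.classRel.trans hk (S.classRel.symm ha')), by rw [inv_inv]⟩

theorem isSNormal_vanishingOffRel (N : Subgroup G) : S.IsSNormal (S.vanishingOffRel N) := by
  refine S.isSNormal_closure ?_
  rintro g ⟨χ, hχ, hg⟩ k hk
  refine ⟨χ, hχ, ?_⟩
  obtain ⟨⟨_, ⟨φ, rfl⟩, rfl⟩, -⟩ := hχ
  have := S.σ_rel φ hk
  unfold σ at this
  rwa [this]

theorem isSNormal_V : ∀ i, S.IsSNormal (S.V i)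
  | 0 => S.isSNormal_iff.2 fun _ _ _ _ => trivial
  | 1 => S.isSNormal_vanishingOffRel _
  | i + 2 => S.isSNormal_commutator (isSNormal_V (i + 1))

instance normal_V (i : ℕ) : (S.V i).Normal := (S.isSNormal_V i).normal

end SupercharacterTheory

section Inflation

variable {G : Type*} [Group G] (N : Subgroup G) [N.Normal]

theorem irreducible_comp_mk_iff {V : Type*} [AddCommGroup V] [Module ℂ V]
    (ρ : Representation ℂ (G ⧸ N) V) :
    Representation.IsIrreducible (ρ.comp (QuotientGroup.mk' N) : Representation ℂ G V) ↔
      ρ.IsIrreducible := by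
  let e : Subrepresentation (ρ.comp (QuotientGroup.mk' N) : Representation ℂ G V) ≃o
      Subrepresentation ρ :=
    { toFun := fun W => ⟨W.toSubmodule, fun x v hv => by
        obtain ⟨g, rfl⟩ := QuotientGroup.mk_surjective x
        exact W.apply_mem_toSubmodule g hv⟩
      invFun := fun W => ⟨W.toSubmodule, fun g v hv => W.apply_mem_toSubmodule (g : G ⧸ N) hv⟩
      left_inv := fun _ => rfl
      right_inv := fun _ => rfl
      map_rel_iff' := Iff.rfl }
  exact e.isSimpleOrder_iff

namespace Irr

/-- Inflation of characters from `G/N` to `G`. -/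
def inflate (χ : Irr (G ⧸ N)) : Irr G :=
  ⟨fun g => χ.1 g, by
    obtain ⟨χ, V, _, _, _, ρ, hρ, rfl⟩ := χ
    exact ⟨V, _, _, inferInstance, ρ.comp (QuotientGroup.mk' N),
      (irreducible_comp_mk_iff N ρ).2 hρ, rfl⟩⟩

theorem inflate_injective : Function.Injective (inflate N) := by
  intro χ ψ h
  apply Subtype.ext
  funext x
  obtain ⟨g, rfl⟩ := QuotientGroup.mk_surjective x
  exact congrFun (congrArg Subtype.val h) g

open Classical in
/-- A character whose sum over `N` is not zero is inflated from `G/N`. -/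
theorem mem_range_inflate [Fintype G] (χ : Irr G)
    (h : ∑ g, χ.1 g⁻¹ * (if g ∈ N then 1 else 0) ≠ 0) : χ ∈ Set.range (inflate N) := by
  obtain ⟨χ, V, _, _, _, ρ, hρ, rfl⟩ := χ
  let f : G → ℂ := fun g => if g ∈ N then 1 else 0
  obtain ⟨c, hc⟩ := sum_smul_scalar ρ hρ f fun g k => by
    have : k * g * k⁻¹ ∈ N ↔ g ∈ N :=
      (Subgroup.Normal.mem_comm_iff inferInstance).trans (by rw [inv_mul_cancel_left])
    simp only [f, this]
  have hc0 : c ≠ 0 := by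
    rintro rfl
    apply h
    have := congrArg (LinearMap.trace ℂ V) hc
    rw [zero_smul, map_zero, map_sum] at this
    refine Eq.trans (Finset.sum_congr rfl fun g _ => ?_) this
    rw [map_smul, smul_eq_mul, mul_comm]; rfl
  have triv : ∀ n ∈ N, ρ n = 1 := by
    intro n hn
    have : ρ n * ∑ g, f g • ρ g⁻¹ = ∑ g, f g • ρ g⁻¹ := by
      rw [Finset.mul_sum]
      refine Fintype.sum_equiv (Equiv.mulRight n⁻¹) _ _ fun g => ?_
      have : g * n⁻¹ ∈ N ↔ g ∈ N := N.mul_mem_cancel_right (inv_mem hn)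
      simp only [Equiv.coe_mulRight, f, this, mul_smul_comm, ← map_mul, mul_inv_rev, inv_inv]
    rw [hc, mul_smul_comm, mul_one] at this
    exact smul_right_injective _ hc0 this
  let ρ' : Representation ℂ (G ⧸ N) V := QuotientGroup.lift N ρ triv
  refine ⟨⟨ρ'.character, V, _, _, inferInstance, ρ', ?_, rfl⟩, rfl⟩
  rw [← irreducible_comp_mk_iff]
  exact hρ

open Classical in
theorem sum_inflate [Fintype G] (χ : Irr (G ⧸ N)) :
    ∑ g, (inflate N χ).1 g⁻¹ * (if g ∈ N then 1 else 0) ≠ 0 := by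
  have : ∑ g, (inflate N χ).1 g⁻¹ * (if g ∈ N then 1 else 0) =
      ((Finset.univ.filter fun g => g ∈ N).card : ℂ) * χ.1 1 := by
    rw [Finset.card_filter]
    push_cast
    rw [Finset.sum_mul]
    refine Finset.sum_congr rfl fun g _ => ?_
    by_cases h : g ∈ N
    · have : ((g⁻¹ : G) : G ⧸ N) = 1 := (QuotientGroup.eq_one_iff _).2 (inv_mem h)
      simp [h, inflate, this]
    · simp [h]
  rw [this]
  refine mul_ne_zero ?_ (degree_ne_zero χ)
  exact_mod_cast (Finset.card_pos.2 ⟨1, by simp [one_mem]⟩).ne'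

end Irr

end Inflation

namespace SupercharacterTheory

variable {G : Type*} [Group G] [Finite G] (S : SupercharacterTheory G)
  (N : Subgroup G) [N.Normal]

/-- The partition of `G/N` into the images of the superclasses. -/
def deflationClassRel (hN : S.IsSNormal N) : Setoid (G ⧸ N) where
  r x y := ∃ g h : G, (g : G ⧸ N) = x ∧ (h : G ⧸ N) = y ∧ S.classRel g h
  iseqv :=
    { refl := fun x => by
        obtain ⟨g, rfl⟩ := QuotientGroup.mk_surjective x
        exact ⟨g, g, rfl, rfl, S.classRel.refl g⟩
      symm := fun ⟨g, h, hg, hh, r⟩ => ⟨h, g, hh, hg, S.classRel.symm r⟩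
      trans := by
        rintro _ _ _ ⟨g, h, rfl, rfl, r⟩ ⟨h', k, e, rfl, r'⟩
        have e' : h' = h * (h⁻¹ * h') := by group
        rw [e'] at r'
        obtain ⟨a, b, ha, hb, rfl⟩ := S.exists_of_rel_mul (S.classRel.symm r')
        have hbN : b ∈ N := S.isSNormal_iff.1 hN _ (QuotientGroup.eq.1 e.symm) b hb
        refine ⟨g, a, rfl, ?_, S.classRel.trans r (S.classRel.symm ha)⟩
        exact QuotientGroup.eq.2 (by simpa using hbN) }

/-- The partition of `Irr(G/N)` induced from the one of `Irr(G)` by inflation. -/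
def deflationCharRel : Setoid (Irr (G ⧸ N)) := S.charRel.comap (Irr.inflate N)

theorem mem_range_inflate_of_rel (hN : S.IsSNormal N) (χ : Irr (G ⧸ N)) (ψ : Irr G)
    (r : S.charRel ψ (Irr.inflate N χ)) : ψ ∈ Set.range (Irr.inflate N) := by
  classical
  have := Fintype.ofFinite G
  apply Irr.mem_range_inflate
  have h1 := S.inner_proportional (S.indicator_rel hN) r
  intro h0
  rw [h0, zero_mul] at h1
  exact mul_ne_zero (Irr.sum_inflate N χ) (Irr.degree_ne_zero ψ) h1.symm

theorem charSum_deflation (hN : S.IsSNormal N) (χ : Irr (G ⧸ N)) (g : G) :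
    charSum {ψ | S.deflationCharRel N ψ χ} (g : G ⧸ N) = S.σ (Irr.inflate N χ) g := by
  unfold σ charSum
  symm
  refine (finsum_mem_eq_of_bijOn (Irr.inflate N) ⟨?_, ?_, ?_⟩ ?_).symm
  · intro ψ hψ; exact hψ
  · exact (Irr.inflate_injective N).injOn
  · intro ψ hψ
    obtain ⟨φ, rfl⟩ := S.mem_range_inflate_of_rel N hN χ ψ hψ
    exact ⟨φ, hψ, rfl⟩
  · intro ψ _
    rfl

theorem deflation_card_eq (hN : S.IsSNormal N) :
    (S.deflationCharRel N).classes.ncard = (S.deflationClassRel N hN).classes.ncard := by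
  classical
  have := Fintype.ofFinite G
  have := Fintype.ofFinite (Quotient (S.deflationCharRel N))
  have := Fintype.ofFinite (Quotient (S.deflationClassRel N hN))
  have hrel : ∀ χ (x y : G ⧸ N), S.deflationClassRel N hN x y →
      charSum {ψ | S.deflationCharRel N ψ χ} x = charSum {ψ | S.deflationCharRel N ψ χ} y := by
    rintro χ _ _ ⟨g, h, rfl, rfl, r⟩
    rw [S.charSum_deflation N hN, S.charSum_deflation N hN, S.σ_rel _ r]
  let F : Quotient (S.deflationCharRel N) → Quotient (S.deflationClassRel N hN) → ℂ := fun p q =>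
    Quotient.liftOn₂ p q (fun χ x => charSum {ψ | S.deflationCharRel N ψ χ} x) (by
      intro χ g ψ h h1 h2
      have : {φ | S.deflationCharRel N φ χ} = {φ | S.deflationCharRel N φ ψ} := by
        ext φ
        exact ⟨fun h => (S.deflationCharRel N).trans h h1,
          fun h => (S.deflationCharRel N).trans h ((S.deflationCharRel N).symm h1)⟩
      simp only [this]
      exact hrel _ _ _ h2)
  have li : LinearIndependent ℂ F := charSum_linearIndependent _ _ F fun _ _ => rfl
  rw [ncard_classes, ncard_classes, Nat.card_eq_fintype_card, Nat.card_eq_fintype_card]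
  apply le_antisymm
  · simpa using li.fintype_card_le_finrank
  · have top : Submodule.span ℂ (Set.range F) = ⊤ := by
      rw [eq_top_iff]
      rintro f -
      let f₀ : G → ℂ := fun g => f (Quotient.mk _ (g : G ⧸ N))
      have hf₀ := S.mem_span f₀ fun g h r => congrArg f (Quotient.sound ⟨g, h, rfl, rfl, r⟩)
      let ind : G → ℂ := fun g => if g ∈ N then 1 else 0
      let s : Quotient (S.deflationClassRel N hN) → G := fun q => q.out.out
      have hs : ∀ q, Quotient.mk _ ((s q : G) : G ⧸ N) = q := fun q => by
        simp [s]
      let Φ : (G → ℂ) →ₗ[ℂ] (Quotient (S.deflationClassRel N hN) → ℂ) :=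
        { toFun := fun e q => ∑ h, e (s q * h⁻¹) * ind h
          map_add' := fun a b => by
            funext q; simp [add_mul, Finset.sum_add_distrib]
          map_smul' := fun c a => by
            funext q; simp [mul_assoc, Finset.mul_sum] }
      have h1 : Φ f₀ = (Nat.card N : ℂ) • f := by
        funext q
        have : ∀ h, f₀ (s q * h⁻¹) * ind h = if h ∈ N then f q else 0 := by
          intro h
          by_cases hh : h ∈ N
          · have : ((s q * h⁻¹ : G) : G ⧸ N) = (s q : G) :=
              QuotientGroup.eq.2 (by simpa using hh)
            simp only [f₀, this, hs, ind, hh, if_true, mul_one]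
          · simp [ind, hh]
        change ∑ h, f₀ (s q * h⁻¹) * ind h = _
        simp only [this]
        rw [← Finset.sum_filter, Finset.sum_const, nsmul_eq_mul, Pi.smul_apply, smul_eq_mul]
        congr 2
        rw [Nat.card_eq_fintype_card, Fintype.card_subtype]
      have h2 : ∀ e ∈ Submodule.span ℂ (Set.range S.σ), Φ e ∈ Submodule.span ℂ (Set.range F) := by
        intro e he
        induction he using Submodule.span_induction with
        | mem e he =>
          obtain ⟨χ, rfl⟩ := he
          have key : ∀ q, χ.1 1 * Φ (S.σ χ) q = (∑ h, χ.1 h⁻¹ * ind h) * S.σ χ (s q) := fun q =>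
            S.conv_σ (S.indicator_rel hN) χ (s q)
          by_cases h0 : ∑ h, χ.1 h⁻¹ * ind h = 0
          · have : Φ (S.σ χ) = 0 := by
              funext q
              have := key q
              rw [h0, zero_mul] at this
              exact (mul_eq_zero.1 this).resolve_left (Irr.degree_ne_zero χ)
            rw [this]
            exact zero_mem _
          · obtain ⟨ψ, rfl⟩ := Irr.mem_range_inflate N χ h0
            have : Φ (S.σ (Irr.inflate N ψ)) = ((∑ h, (Irr.inflate N ψ).1 h⁻¹ * ind h) /
                (Irr.inflate N ψ).1 1) • F (Quotient.mk _ ψ) := by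
              funext q
              have hF : F (Quotient.mk _ ψ) q = S.σ (Irr.inflate N ψ) (s q) := by
                rw [← S.charSum_deflation N hN]
                conv_lhs => rw [← hs q]
                rfl
              rw [Pi.smul_apply, smul_eq_mul, hF]
              have := key q
              have hd := Irr.degree_ne_zero (Irr.inflate N ψ)
              field_simp
              linear_combination this
            rw [this]
            exact Submodule.smul_mem _ _ (Submodule.subset_span ⟨_, rfl⟩)
        | zero => simp
        | add a b _ _ ha hb => rw [map_add]; exact add_mem ha hb
        | smul c a _ ha => rw [map_smul]; exact Submodule.smul_mem _ _ ha
      have h3 := h2 f₀ hf₀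
      rw [h1] at h3
      exact (Submodule.smul_mem_iff _ (by exact_mod_cast Nat.card_pos.ne')).1 h3
    have := finrank_range_le_card (R := ℂ) F
    unfold Set.finrank at this
    rw [top, finrank_top, Module.finrank_fintype_fun_eq_card] at this
    exact this

/-- The deflation `S^{G/N}`: its superclasses are the images of the superclasses of `S`. -/
def deflation (hN : S.IsSNormal N) : SupercharacterTheory (G ⧸ N) where
  charRel := S.deflationCharRel N
  classRel := S.deflationClassRel N hN
  one_mem_classes := by
    refine ⟨1, ?_⟩
    ext x
    constructor
    · rintro rfl
      exact (S.deflationClassRel N hN).refl 1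
    · rintro ⟨g, h, rfl, hh, r⟩
      exact (QuotientGroup.eq_one_iff g).2
        (S.isSNormal_iff.1 hN h ((QuotientGroup.eq_one_iff h).1 hh) g r)
  card_eq := S.deflation_card_eq N hN
  constant := by
    rintro _ ⟨χ, rfl⟩ _ ⟨z, rfl⟩ x hx y hy
    obtain ⟨g, h, rfl, rfl, r⟩ := (S.deflationClassRel N hN).trans hx
      ((S.deflationClassRel N hN).symm hy)
    rw [S.charSum_deflation N hN, S.charSum_deflation N hN, S.σ_rel _ r]

/-- The superclasses of `S^{G/N}` are the images `π(K)` of the superclasses `K` of `S`. -/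
theorem deflation_classes (hN : S.IsSNormal N) :
    (S.deflation N hN).classRel.classes =
      (fun K => (QuotientGroup.mk '' K : Set (G ⧸ N))) '' S.classRel.classes := by
  have key : ∀ g : G, {x | S.deflationClassRel N hN x (g : G ⧸ N)} =
      QuotientGroup.mk '' {k | S.classRel k g} := by
    intro g
    ext x
    constructor
    · rintro ⟨a, b, rfl, hb, r⟩
      have e : b = g * (g⁻¹ * b) := by group
      rw [e] at r
      obtain ⟨c, d, hc, hd, rfl⟩ := S.exists_of_rel_mul r
      have hdN : d ∈ N := S.isSNormal_iff.1 hN _ (QuotientGroup.eq.1 hb.symm) d hd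
      exact ⟨c, hc, QuotientGroup.eq.2 (by simpa using hdN)⟩
    · rintro ⟨a, ha, rfl⟩
      exact ⟨a, g, rfl, rfl, ha⟩
  ext K
  constructor
  · rintro ⟨x, rfl⟩
    obtain ⟨g, rfl⟩ := QuotientGroup.mk_surjective x
    exact ⟨_, ⟨g, rfl⟩, (key g).symm⟩
  · rintro ⟨_, ⟨g, rfl⟩, rfl⟩
    exact ⟨g, (key g).symm⟩

/-- The center `Z(S)`, the subgroup of all `g` with `|Cl_S(g)| = 1`. -/
def center : Subgroup G where
  carrier := {g | (S.superclass g).ncard = 1}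
  one_mem' := S.mem_center_aux.2 fun _ => S.eq_one_of_rel
  mul_mem' := by
    intro x y hx hy
    refine S.mem_center_aux.2 fun k hk => ?_
    obtain ⟨a, b, ha, hb, rfl⟩ := S.exists_of_rel_mul hk
    rw [S.mem_center_aux.1 hx a ha, S.mem_center_aux.1 hy b hb]
  inv_mem' := by
    intro x hx
    refine S.mem_center_aux.2 fun k hk => ?_
    have := S.rel_inv hk
    rw [inv_inv] at this
    rw [← S.mem_center_aux.1 hx _ this, inv_inv]

theorem isSNormal_comap_center (hN : S.IsSNormal N) :
    S.IsSNormal ((S.deflation N hN).center.comap (QuotientGroup.mk' N)) := by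
  rw [isSNormal_iff]
  intro g hg k hk
  have h1 := (S.deflation N hN).mem_center_aux.1 hg (k : G ⧸ N) ⟨k, g, rfl, rfl, hk⟩
  change (k : G ⧸ N) ∈ (S.deflation N hN).center
  rw [h1]
  exact hg

/-- An `S`-central series `G = N_0 ≥ N_1 ≥ ⋯ ≥ N_r = 1`: a series of `S`-normal subgroups with
`N_i / N_{i+1} ≤ Z(S^{G/N_{i+1}})`. -/
structure CentralSeries where
  /-- The length of the series. -/
  length : ℕ
  /-- The terms of the series; those of index larger than `length` are not used. -/
  term : ℕ → Subgroup G
  sNormal : ∀ i, S.IsSNormal (term i)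
  first : term 0 = ⊤
  last : term length = ⊥
  le : ∀ i < length, term (i + 1) ≤ term i
  central : ∀ i < length, have := (sNormal (i + 1)).normal
    (term i).map (QuotientGroup.mk' (term (i + 1))) ≤
      (S.deflation (term (i + 1)) (sNormal (i + 1))).center

/-- `G` is `S`-nilpotent if it has an `S`-central series. -/
def IsNilpotent : Prop := Nonempty S.CentralSeries

/-- The upper `S`-central series `ζ_0 = 1`, `ζ_{i+1} / ζ_i = Z(S^{G/ζ_i})`, together with the
`S`-normality of its terms. -/
def ζAux : ℕ → {N : Subgroup G // S.IsSNormal N}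
  | 0 => ⟨⊥, S.isSNormal_iff.2 fun g hg k hk => by
      rw [Subgroup.mem_bot] at hg ⊢
      subst hg
      exact S.eq_one_of_rel hk⟩
  | i + 1 =>
    have := (ζAux i).2.normal
    ⟨(S.deflation (ζAux i).1 (ζAux i).2).center.comap (QuotientGroup.mk' (ζAux i).1),
      S.isSNormal_comap_center (ζAux i).1 (ζAux i).2⟩

/-- The upper `S`-central series. -/
def ζ (i : ℕ) : Subgroup G := (S.ζAux i).1

/-- `G` is `S`-nilpotent of `S`-nilpotence class `n`: the least positive integer `c` with
`ζ_c = G` is `n`. -/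
def IsNilpotentOfClass (n : ℕ) : Prop :=
  S.IsNilpotent ∧ IsLeast {c : ℕ | 0 < c ∧ S.ζ c = ⊤} n

end SupercharacterTheory

/-!
The argument rests on three facts.

* The `S`-normal subgroups are visible in the supercharacters. A supercharacter `σ` has an
  `S`-normal subgroup `N` in its kernel exactly when `∑_{h ∈ N} σ(h) ≠ 0`
  (`subset_charKer_of_sum_ne_zero`), and every `g ∉ N` is separated from `1` by such a
  supercharacter (`exists_subset_charKer`). This gives `[G, S] ≤ V(S)`
  (`commutator_top_le_vanishingOff`): otherwise some supercharacter has `[G, S] ∩ V(S)` but not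
  `[G, S]` in its kernel; it vanishes off `V(S)`, so its sum over `[G, S]` is its sum over
  `[G, S] ∩ V(S)`, which is not zero, a contradiction. The inclusions between the two series and
  the propagation of `V_i = γ_i` to larger `i` follow because `[·, S]` is monotone.

* The operation `[·, S]` commutes with the passage to a quotient (`commutator_deflation`), and
  `[H, S] ≤ N` says that `H N / N` is central in `S^{G/N}` (`commutator_le_iff_map_le_center`).
  So the lower series of `S^{G/V_n}` is the image of that of `S`, and since
  `γ_{n+1} ≤ V_n < γ_n` it reaches the trivial subgroup at step `n + 1` and no earlier; by the
  duality of the upper and lower series (`ζ_eq_top_iff`) the class is `n`.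

* If `V_n < γ_n` with `n ≥ 2`, then `V_2 < γ_2`, so some supercharacter `σ` has `V_2` but not
  `γ_2` in its kernel. For `g ∈ V_1` the superclasses of the elements of `g V_2` stay in `g V_2`,
  and convolution of `σ` with the indicator function of `g V_2` shows `σ(g) ≠ 0`
  (`σ_ne_zero_of_superclass_subset`). Since `σ` is inflated from `G/V_n`, this puts the image of
  `g` in `V(S^{G/V_n})`. The reverse inclusion `V(S^{G/N}) ≤ V(S) N / N` holds for every `N`
  (`vanishingOff_deflation_le`).
-/

namespace SupercharacterTheory

/-! ### Supercharacters and their kernels -/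

section Kernels

variable {G : Type*} [Group G] (S : SupercharacterTheory G)

theorem superchars_eq_range : S.superchars = Set.range S.σ := by
  ext χ
  constructor
  · rintro ⟨_, ⟨φ, rfl⟩, rfl⟩
    exact ⟨φ, rfl⟩
  · rintro ⟨φ, rfl⟩
    exact ⟨_, ⟨φ, rfl⟩, rfl⟩

theorem mem_supercharsNotContaining {N : Subgroup G} {χ : G → ℂ} :
    χ ∈ S.supercharsNotContaining N ↔
      ∃ φ, S.σ φ = χ ∧ ¬ (N : Set G) ⊆ charKer (S.σ φ) := by
  unfold supercharsNotContaining
  rw [superchars_eq_range]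
  constructor
  · rintro ⟨⟨φ, rfl⟩, h⟩
    exact ⟨φ, rfl, h⟩
  · rintro ⟨φ, rfl, h⟩
    exact ⟨⟨φ, rfl⟩, h⟩

theorem mem_vanishingOff_of_ne_zero {φ : Irr G}
    (h : ¬ (S.commutator ⊤ : Set G) ⊆ charKer (S.σ φ)) {g : G} (hg : S.σ φ g ≠ 0) :
    g ∈ S.vanishingOff :=
  Subgroup.subset_closure ⟨_, S.mem_supercharsNotContaining.2 ⟨φ, rfl, h⟩, hg⟩

variable [Finite G]

theorem σ_one_ne_zero (χ : Irr G) : S.σ χ 1 ≠ 0 := by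
  classical
  have := Fintype.ofFinite (Irr G)
  choose d hd0 hd using fun ψ : Irr G => Irr.degree ψ
  have e : S.σ χ 1 = ((∑ ψ : Irr G, if S.charRel ψ χ then d ψ * d ψ else 0 : ℕ) : ℂ) := by
    unfold σ
    rw [charSum_eq]
    push_cast
    refine Finset.sum_congr rfl fun ψ _ => ?_
    simp only [Set.mem_ofPred_eq, hd]
  rw [e, Nat.cast_ne_zero]
  refine (Finset.sum_pos' (fun _ _ => Nat.zero_le _) ⟨χ, Finset.mem_univ _, ?_⟩).ne'
  rw [if_pos (S.charRel.refl χ)]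
  exact Nat.mul_pos (Nat.pos_of_ne_zero (hd0 χ)) (Nat.pos_of_ne_zero (hd0 χ))

variable {S} {N : Subgroup G}

theorem sum_ne_zero_of_subset_charKer [Fintype G] [DecidablePred (· ∈ N)] {χ : Irr G}
    (h : (N : Set G) ⊆ charKer (S.σ χ)) : ∑ g, (if g ∈ N then S.σ χ g else 0) ≠ 0 := by
  have hσ : ∀ g, (if g ∈ N then S.σ χ g else 0) = if g ∈ N then S.σ χ 1 else 0 := fun g =>
    ite_congr rfl (fun hg => h hg) fun _ => rfl
  rw [Finset.sum_congr rfl fun g _ => hσ g, ← Finset.sum_filter, Finset.sum_const, nsmul_eq_mul]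
  refine mul_ne_zero ?_ (S.σ_one_ne_zero χ)
  exact_mod_cast (Finset.card_pos.2 ⟨1, by simp [one_mem]⟩).ne'

/-- A supercharacter whose sum over `N` is not zero comes from the quotient `G/N`: convolution
with the indicator function of `N` acts on it by a scalar. -/
theorem mem_range_inflate_of_sum_ne_zero [N.Normal] [Fintype G] [DecidablePred (· ∈ N)]
    (hN : S.IsSNormal N) {χ : Irr G} (h : ∑ g, (if g ∈ N then S.σ χ g else 0) ≠ 0) :
    χ ∈ Set.range (Irr.inflate N) := by
  classical
  apply Irr.mem_range_inflate
  intro h0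
  have key := S.conv_σ (S.indicator_rel hN) χ 1
  rw [h0, zero_mul] at key
  refine h (Eq.trans ?_ ((mul_eq_zero.1 key).resolve_left (Irr.degree_ne_zero χ)))
  refine Fintype.sum_equiv (Equiv.inv G) _ _ fun g => ?_
  by_cases hg : g ∈ N <;> simp [hg]

theorem σ_deflation [N.Normal] (hN : S.IsSNormal N) (χ : Irr (G ⧸ N)) (g : G) :
    (S.deflation N hN).σ χ (g : G ⧸ N) = S.σ (Irr.inflate N χ) g :=
  S.charSum_deflation N hN χ g

theorem subset_charKer_inflate [N.Normal] (hN : S.IsSNormal N) (χ : Irr (G ⧸ N)) :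
    (N : Set G) ⊆ charKer (S.σ (Irr.inflate N χ)) := by
  intro g hg
  change S.σ (Irr.inflate N χ) g = S.σ (Irr.inflate N χ) 1
  rw [← σ_deflation hN, ← σ_deflation hN, (QuotientGroup.eq_one_iff g).2 hg, QuotientGroup.mk_one]

theorem subset_charKer_of_sum_ne_zero [Fintype G] [DecidablePred (· ∈ N)]
    (hN : S.IsSNormal N) {χ : Irr G} (h : ∑ g, (if g ∈ N then S.σ χ g else 0) ≠ 0) :
    (N : Set G) ⊆ charKer (S.σ χ) := by
  have := hN.normal
  obtain ⟨ψ, rfl⟩ := mem_range_inflate_of_sum_ne_zero hN h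
  exact subset_charKer_inflate hN ψ

theorem mem_range_inflate_of_subset_charKer [N.Normal] (hN : S.IsSNormal N) {χ : Irr G}
    (h : (N : Set G) ⊆ charKer (S.σ χ)) : χ ∈ Set.range (Irr.inflate N) := by
  classical
  have := Fintype.ofFinite G
  exact mem_range_inflate_of_sum_ne_zero hN (sum_ne_zero_of_subset_charKer h)

/-- An `S`-normal subgroup is the intersection of the kernels of the supercharacters that
contain it. -/
theorem exists_subset_charKer (hN : S.IsSNormal N) {g : G} (hg : g ∉ N) :
    ∃ χ, (N : Set G) ⊆ charKer (S.σ χ) ∧ g ∉ charKer (S.σ χ) := by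
  have := hN.normal
  by_contra! H
  refine hg ((QuotientGroup.eq_one_iff g).1 ((S.deflation N hN).eq_one_of_rel ?_))
  rw [rel_iff]
  intro χ
  rw [σ_deflation, ← QuotientGroup.mk_one, σ_deflation]
  exact H _ (subset_charKer_inflate hN χ)

/-- If the superclasses of the elements of `g N` stay in `g N`, a supercharacter with `N` in its
kernel does not vanish at `g`. -/
theorem σ_ne_zero_of_superclass_subset {χ : Irr G} (h : (N : Set G) ⊆ charKer (S.σ χ)) {g : G}
    (hg : ∀ x y, g⁻¹ * x ∈ N → S.classRel y x → g⁻¹ * y ∈ N) : S.σ χ g ≠ 0 := by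
  classical
  have := Fintype.ofFinite G
  intro h0
  have key := S.conv_σ (f := fun x => if g⁻¹ * x ∈ N then 1 else 0) (fun x y r => by
    have : g⁻¹ * x ∈ N ↔ g⁻¹ * y ∈ N := ⟨fun hx => hg x y hx (S.classRel.symm r),
      fun hy => hg y x hy r⟩
    simp only [this]) χ g
  rw [h0, mul_zero] at key
  refine sum_ne_zero_of_subset_charKer h
    (Eq.trans ?_ ((mul_eq_zero.1 key).resolve_left (Irr.degree_ne_zero χ)))
  have conj_mem : ∀ x, g⁻¹ * x ∈ N → S.σ χ (g * x⁻¹) = S.σ χ 1 := by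
    intro x hx
    rw [← h (inv_mem hx)]
    unfold σ
    rw [← charSum_conj _ (g * x⁻¹) g⁻¹]
    congr 1
    group
  refine Fintype.sum_equiv (Equiv.mulLeft g) _ _ fun x => ?_
  by_cases hx : x ∈ N
  · have := conj_mem (g * x) (by simpa using hx)
    simp only [Equiv.coe_mulLeft, inv_mul_cancel_left, hx, if_true, this, mul_one]
    exact h hx
  · simp [hx]

end Kernels

/-! ### The subgroups `[H, S]` and the two descending series -/

section Commutator

variable {G : Type*} [Group G] (S : SupercharacterTheory G)

theorem commutator_le {H K : Subgroup G} :
    S.commutator H ≤ K ↔ ∀ g ∈ H, ∀ k, S.classRel k g → g⁻¹ * k ∈ K := by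
  unfold commutator
  rw [Subgroup.closure_le]
  constructor
  · intro h g hg k hk
    exact h ⟨g, hg, k, hk, rfl⟩
  · rintro h _ ⟨g, hg, k, hk, rfl⟩
    exact h g hg k hk

theorem inv_mul_mem_commutator {H : Subgroup G} {g k : G} (hg : g ∈ H) (hk : S.classRel k g) :
    g⁻¹ * k ∈ S.commutator H := S.commutator_le.1 le_rfl g hg k hk

theorem commutator_mono {H K : Subgroup G} (h : H ≤ K) : S.commutator H ≤ S.commutator K :=
  S.commutator_le.2 fun _ hg _ hk => S.inv_mul_mem_commutator (h hg) hk

variable {S} in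
theorem IsSNormal.commutator_le {H : Subgroup G} (hH : S.IsSNormal H) : S.commutator H ≤ H :=
  S.commutator_le.2 fun g hg k hk => mul_mem (inv_mem hg) (S.isSNormal_iff.1 hH g hg k hk)

theorem γ_succ {i : ℕ} (hi : 1 ≤ i) : S.γ (i + 1) = S.commutator (S.γ i) := by
  obtain ⟨i, rfl⟩ := Nat.exists_eq_add_of_le' hi
  rfl

theorem V_succ {i : ℕ} (hi : 1 ≤ i) : S.V (i + 1) = S.commutator (S.V i) := by
  obtain ⟨i, rfl⟩ := Nat.exists_eq_add_of_le' hi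
  rfl

theorem V_le_γ (i : ℕ) : S.V i ≤ S.γ i := by
  rcases Nat.eq_zero_or_pos i with rfl | hi
  · exact le_rfl
  · induction i, hi using Nat.le_induction with
    | base => exact le_top
    | succ i hi ih =>
      rw [S.V_succ hi, S.γ_succ hi]
      exact S.commutator_mono ih

/-- Once the two series agree they agree from there on, since both are continued by `[·, S]`. -/
theorem V_eq_γ_of_le {i n : ℕ} (hi : 1 ≤ i) (hin : i ≤ n) (h : S.V i = S.γ i) :
    S.V n = S.γ n := by
  induction n, hin using Nat.le_induction with
  | base => exact h
  | succ n hn ih => rw [S.V_succ (hi.trans hn), S.γ_succ (hi.trans hn), ih]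

theorem V_lt_γ_of_le {i n : ℕ} (hi : 1 ≤ i) (hin : i ≤ n) (h : S.V n < S.γ n) :
    S.V i < S.γ i :=
  lt_of_le_of_ne (S.V_le_γ i) fun e => h.ne (S.V_eq_γ_of_le hi hin e)

variable [Finite G]

theorem isSNormal_γ : ∀ i, S.IsSNormal (S.γ i)
  | 0 => S.isSNormal_iff.2 fun _ _ _ _ => trivial
  | 1 => S.isSNormal_iff.2 fun _ _ _ _ => trivial
  | i + 2 => S.isSNormal_commutator (isSNormal_γ (i + 1))

theorem γ_antitone : Antitone S.γ := by
  refine antitone_nat_of_succ_le fun i => ?_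
  rcases Nat.eq_zero_or_pos i with rfl | hi
  · exact le_rfl
  · rw [S.γ_succ hi]
    exact (S.isSNormal_γ i).commutator_le

theorem V_antitone : Antitone S.V := by
  refine antitone_nat_of_succ_le fun i => ?_
  rcases Nat.eq_zero_or_pos i with rfl | hi
  · exact le_top
  · rw [S.V_succ hi]
    exact (S.isSNormal_V i).commutator_le

theorem commutator_top_le_vanishingOff : S.commutator ⊤ ≤ S.vanishingOff := by
  classical
  have := Fintype.ofFinite G
  have hN : S.IsSNormal (S.commutator ⊤) := S.isSNormal_γ 2
  have hV : S.IsSNormal S.vanishingOff := S.isSNormal_V 1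
  have hM : S.IsSNormal (S.commutator ⊤ ⊓ S.vanishingOff) := S.isSNormal_iff.2 fun g hg k hk =>
    ⟨S.isSNormal_iff.1 hN g hg.1 k hk, S.isSNormal_iff.1 hV g hg.2 k hk⟩
  intro g hg
  by_contra hgV
  obtain ⟨χ, hχ, hgχ⟩ := exists_subset_charKer hM fun h : g ∈ _ => hgV h.2
  have hker : ¬ (S.commutator ⊤ : Set G) ⊆ charKer (S.σ χ) := fun h => hgχ (h hg)
  -- `σ_χ` vanishes off `V(S)`, so its sums over `[G, S]` and over `[G, S] ∩ V(S)` agree.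
  have hsum : ∀ x, (if x ∈ S.commutator ⊤ then S.σ χ x else 0) =
      if x ∈ S.commutator ⊤ ⊓ S.vanishingOff then S.σ χ x else 0 := by
    intro x
    by_cases hx : S.σ χ x = 0
    · simp only [hx, ite_self]
    · simp only [Subgroup.mem_inf, S.mem_vanishingOff_of_ne_zero hker hx, and_true]
  refine hker (subset_charKer_of_sum_ne_zero hN ?_)
  rw [Finset.sum_congr rfl fun x _ => hsum x]
  exact sum_ne_zero_of_subset_charKer hχ

theorem γ_succ_le_V {i : ℕ} (hi : 1 ≤ i) : S.γ (i + 1) ≤ S.V i := by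
  induction i, hi using Nat.le_induction with
  | base => exact S.commutator_top_le_vanishingOff
  | succ i hi ih =>
    rw [S.V_succ hi, S.γ_succ (Nat.le_add_left 1 i)]
    exact S.commutator_mono ih

end Commutator

/-! ### Passage to quotients -/

section Deflation

variable {G : Type*} [Group G] [Finite G] {S : SupercharacterTheory G}
  {N : Subgroup G} [N.Normal]

theorem deflation_rel_mk (hN : S.IsSNormal N) {x : G ⧸ N} {g : G} :
    (S.deflation N hN).classRel x g ↔ ∃ k, S.classRel k g ∧ (k : G ⧸ N) = x := by
  constructor
  · rintro ⟨a, b, rfl, hb, r⟩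
    rw [← mul_inv_cancel_left g b] at r
    obtain ⟨c, d, hc, hd, rfl⟩ := S.exists_of_rel_mul r
    have hdN : d ∈ N := S.isSNormal_iff.1 hN _ (QuotientGroup.eq.1 hb.symm) d hd
    exact ⟨c, hc, QuotientGroup.eq.2 (by simpa using hdN)⟩
  · rintro ⟨k, hk, rfl⟩
    exact ⟨k, g, rfl, rfl, hk⟩

theorem commutator_deflation (hN : S.IsSNormal N) (H : Subgroup G) :
    (S.deflation N hN).commutator (H.map (QuotientGroup.mk' N)) =
      (S.commutator H).map (QuotientGroup.mk' N) := by
  apply le_antisymm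
  · rw [commutator_le]
    rintro _ ⟨g, hg, rfl⟩ _ hx
    obtain ⟨k, hk, rfl⟩ := (deflation_rel_mk hN).1 hx
    exact ⟨g⁻¹ * k, S.inv_mul_mem_commutator hg hk, rfl⟩
  · rw [Subgroup.map_le_iff_le_comap, commutator_le]
    intro g hg k hk
    exact (S.deflation N hN).inv_mul_mem_commutator
      (Subgroup.mem_map_of_mem (QuotientGroup.mk' N) hg) ((deflation_rel_mk hN).2 ⟨k, hk, rfl⟩)

theorem commutator_top_deflation (hN : S.IsSNormal N) :
    (S.deflation N hN).commutator ⊤ = (S.commutator ⊤).map (QuotientGroup.mk' N) := by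
  rw [← commutator_deflation hN,
    Subgroup.map_top_of_surjective _ (QuotientGroup.mk'_surjective N)]

theorem γ_deflation (hN : S.IsSNormal N) (i : ℕ) :
    (S.deflation N hN).γ i = (S.γ i).map (QuotientGroup.mk' N) := by
  have top : (⊤ : Subgroup (G ⧸ N)) = (⊤ : Subgroup G).map (QuotientGroup.mk' N) :=
    (Subgroup.map_top_of_surjective _ (QuotientGroup.mk'_surjective N)).symm
  rcases Nat.eq_zero_or_pos i with rfl | hi
  · exact top
  · induction i, hi using Nat.le_induction with
    | base => exact top
    | succ i hi ih => rw [γ_succ _ hi, γ_succ _ hi, ih, commutator_deflation]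

theorem commutator_top_subset_charKer_deflation (hN : S.IsSNormal N) (χ : Irr (G ⧸ N)) :
    ((S.deflation N hN).commutator ⊤ : Set (G ⧸ N)) ⊆ charKer ((S.deflation N hN).σ χ) ↔
      (S.commutator ⊤ : Set G) ⊆ charKer (S.σ (Irr.inflate N χ)) := by
  have mem : ∀ g : G, (g : G ⧸ N) ∈ charKer ((S.deflation N hN).σ χ) ↔
      g ∈ charKer (S.σ (Irr.inflate N χ)) := by
    intro g
    change (S.deflation N hN).σ χ g = (S.deflation N hN).σ χ ((1 : G) : G ⧸ N) ↔ _
    rw [σ_deflation, σ_deflation]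
    rfl
  rw [commutator_top_deflation]
  constructor
  · intro h g hg
    exact (mem g).1 (h (Subgroup.mem_map_of_mem (QuotientGroup.mk' N) hg))
  · rintro h _ ⟨g, hg, rfl⟩
    exact (mem g).2 (h hg)

theorem vanishingOff_deflation_le (hN : S.IsSNormal N) :
    (S.deflation N hN).vanishingOff ≤ S.vanishingOff.map (QuotientGroup.mk' N) := by
  refine (Subgroup.closure_le _).2 ?_
  rintro x ⟨_, hχ, hx⟩
  obtain ⟨χ, rfl, hker⟩ := (mem_supercharsNotContaining _).1 hχ
  obtain ⟨g, rfl⟩ := QuotientGroup.mk_surjective x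
  rw [commutator_top_subset_charKer_deflation] at hker
  rw [σ_deflation] at hx
  exact ⟨g, S.mem_vanishingOff_of_ne_zero hker hx, rfl⟩

/-- A supercharacter with `V_2` but not `γ_2` in its kernel is inflated from `G/N` and vanishes
nowhere on `V_1`. -/
theorem vanishingOff_deflation (hN : S.IsSNormal N) (hNV : N ≤ S.V 2) (h : S.V 2 < S.γ 2) :
    (S.deflation N hN).vanishingOff = S.vanishingOff.map (QuotientGroup.mk' N) := by
  refine le_antisymm (vanishingOff_deflation_le hN) ?_
  rintro _ ⟨g, hg, rfl⟩
  obtain ⟨k, hk, hkV⟩ := SetLike.exists_of_lt h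
  obtain ⟨χ, hχ, hkχ⟩ := exists_subset_charKer (S.isSNormal_V 2) hkV
  obtain ⟨ψ, rfl⟩ := mem_range_inflate_of_subset_charKer hN (Set.Subset.trans hNV hχ)
  refine (S.deflation N hN).mem_vanishingOff_of_ne_zero (φ := ψ) ?_ ?_
  · rw [commutator_top_subset_charKer_deflation]
    exact fun h => hkχ (h hk)
  · change (S.deflation N hN).σ ψ (g : G ⧸ N) ≠ 0
    rw [σ_deflation]
    refine σ_ne_zero_of_superclass_subset hχ fun x y hx hy => ?_
    have hxV : x ∈ S.V 1 := by
      rw [← mul_inv_cancel_left g x]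
      exact mul_mem hg (S.V_antitone one_le_two hx)
    have := mul_mem hx (S.inv_mul_mem_commutator hxV hy)
    rwa [mul_assoc, mul_inv_cancel_left] at this

theorem V_deflation {n i : ℕ} (h : S.V n < S.γ n) (hi : 1 ≤ i) (hin : i ≤ n) :
    (S.deflation (S.V n) (S.isSNormal_V n)).V i = (S.V i).map (QuotientGroup.mk' (S.V n)) := by
  induction i, hi using Nat.le_induction with
  | base =>
    change (S.deflation _ _).vanishingOff = S.vanishingOff.map _
    rcases hin.eq_or_lt with rfl | hn
    -- For `n = 1` both sides are trivial.
    · refine le_antisymm (vanishingOff_deflation_le _) ?_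
      exact ((QuotientGroup.map_mk'_self (S.V 1)).trans_le bot_le)
    · exact vanishingOff_deflation _ (S.V_antitone hn) (S.V_lt_γ_of_le one_le_two hn h)
  | succ i hi ih =>
    rw [V_succ _ hi, V_succ _ hi, ih (Nat.le_of_succ_le hin), commutator_deflation]

end Deflation

/-! ### Central series and the nilpotence class -/

section Nilpotent

variable {G : Type*} [Group G] [Finite G] {S : SupercharacterTheory G}

theorem commutator_le_iff_map_le_center {N : Subgroup G} [N.Normal] (hN : S.IsSNormal N)
    {H : Subgroup G} :
    S.commutator H ≤ N ↔ H.map (QuotientGroup.mk' N) ≤ (S.deflation N hN).center := by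
  rw [commutator_le, Subgroup.map_le_iff_le_comap]
  refine forall₂_congr fun g _ => ?_
  refine Iff.trans ?_ (mem_center_aux _).symm
  constructor
  · intro h x hx
    obtain ⟨k, hk, rfl⟩ := (deflation_rel_mk hN).1 hx
    exact (QuotientGroup.eq.2 (h k hk)).symm
  · intro h k hk
    exact QuotientGroup.eq.1 (h k ((deflation_rel_mk hN).2 ⟨k, hk, rfl⟩)).symm

theorem le_ζ_succ_iff {H : Subgroup G} {i : ℕ} : H ≤ S.ζ (i + 1) ↔ S.commutator H ≤ S.ζ i := by
  have : (S.ζ i).Normal := (S.ζAux i).2.normal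
  rw [commutator_le_iff_map_le_center (N := S.ζ i) (S.ζAux i).2, Subgroup.map_le_iff_le_comap]
  rfl

/-- The duality between the lower and the upper `S`-central series. -/
theorem γ_le_ζ_iff {i j : ℕ} : S.γ (i + 1) ≤ S.ζ j ↔ S.γ (i + j + 1) = ⊥ := by
  induction j generalizing i with
  | zero => exact le_bot_iff
  | succ j ih =>
    rw [le_ζ_succ_iff, ← S.γ_succ (Nat.le_add_left 1 i), ih]
    congr! 2
    omega

theorem ζ_eq_top_iff {c : ℕ} : S.ζ c = ⊤ ↔ S.γ (c + 1) = ⊥ := by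
  rw [← top_le_iff]
  exact (γ_le_ζ_iff (i := 0)).trans (by rw [Nat.zero_add])

theorem isNilpotent_of_γ_eq_bot {c : ℕ} (h : S.γ (c + 1) = ⊥) : S.IsNilpotent :=
  ⟨{ length := c
     term := fun i => S.γ (i + 1)
     sNormal := fun i => S.isSNormal_γ (i + 1)
     first := rfl
     last := h
     le := fun i _ => S.γ_antitone (Nat.le_succ (i + 1))
     central := fun i _ => by
      have := (S.isSNormal_γ (i + 1 + 1)).normal
      exact (commutator_le_iff_map_le_center _).1 (S.γ_succ (Nat.le_add_left 1 i)).ge }⟩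

theorem isNilpotentOfClass_of_γ {n : ℕ} (hn : 1 ≤ n) (h : S.γ (n + 1) = ⊥) (h' : S.γ n ≠ ⊥) :
    S.IsNilpotentOfClass n := by
  refine ⟨isNilpotent_of_γ_eq_bot h, ⟨hn, ζ_eq_top_iff.2 h⟩, fun c hc => ?_⟩
  by_contra! hcn
  exact h' (le_bot_iff.1 ((S.γ_antitone hcn).trans_eq (ζ_eq_top_iff.1 hc.2)))

end Nilpotent

end SupercharacterTheory

theorem mainTheorem6 {G : Type*} [Group G] [Finite G] (S : SupercharacterTheory G) :
    (∀ i : ℕ, 1 ≤ i → S.γ (i + 1) ≤ S.V i ∧ S.V i ≤ S.γ i) ∧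
    (∀ n : ℕ, 1 ≤ n → S.V n < S.γ n → ∀ i : ℕ, 1 ≤ i → i ≤ n → S.V i < S.γ i) ∧
    (∀ n : ℕ, 1 ≤ n → S.V n < S.γ n →
      (S.deflation (S.V n) (S.isSNormal_V n)).IsNilpotentOfClass n ∧
      ∀ i : ℕ, 1 ≤ i → i ≤ n →
        S.V n ≤ S.V i ∧
        (S.deflation (S.V n) (S.isSNormal_V n)).V i =
          (S.V i).map (QuotientGroup.mk' (S.V n))) := by
  refine ⟨fun i hi => ⟨S.γ_succ_le_V hi, S.V_le_γ i⟩,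
    fun n _ h i hi hin => S.V_lt_γ_of_le hi hin h, fun n hn h => ⟨?_, fun i hi hin =>
      ⟨S.V_antitone hin, SupercharacterTheory.V_deflation h hi hin⟩⟩⟩
  apply SupercharacterTheory.isNilpotentOfClass_of_γ hn
  · rw [SupercharacterTheory.γ_deflation, Subgroup.map_eq_bot_iff, QuotientGroup.ker_mk']
    exact S.γ_succ_le_V hn
  · rw [SupercharacterTheory.γ_deflation, Ne, Subgroup.map_eq_bot_iff, QuotientGroup.ker_mk']
    exact h.not_ge
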